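/- Let $\ell^2(\mathbb{Z})$ be the complex Hilbert space with canonical basis $(e_l)_{l\in\mathbb{Z}}$. A density operator is a positive semidefinite bounded operator $\rho$ on $\ell^2(\mathbb{Z})$ with trace $\sum_{l}\langle e_l,\rho e_l\rangle=1$. It is band-limited by $k\in\mathbb{N}=\{0,1,2,\dots\}$ if $\langle e_i,\rho e_j\rangle=0$ whenever $|i-j|>k$. Let $\|A\|_{\mathcal{B}_2}=\big(\sum_{i,j\in\mathbb{Z}}|\langle e_i,Ae_j\rangle|^2\big)^{1/2}$ be the Hilbert–Schmidt norm. Fix $g\in\mathbb{C}$. For $\theta\in\mathbb{R}$ let $U_\theta$ be the bounded operator on $\ell^2(\mathbb{Z})$ with $$U_\theta e_l=\sum_{m\in\mathbb{Z}}e^{i(m-l)\theta}J_{m-l}(2|g|)\,e_m ,$$ where $J_n$ is the Bessel function of the first kind of integer order $n$, and let $$(T\rho)(\theta,l)=\langle e_l,U_\theta\rho U_\theta^*e_l\rangle,\qquad \theta\in[-\pi,\pi],\ l\in\mathbb{Z}.$$ Let $\|\cdot\|_2$ be the norm of $L^2([-\pi,\pi]\times\mathbb{Z})$. Theorem. Let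 $k\in\mathbb{N}$ and $\mu>\frac{1}{1+2k}$. For every $C>0$ there exist density operators $\rho\neq\sigma$, both band-limited by $k$, such that $$\|\sigma-\rho\|_{\mathcal{B}_2}\ \geq\ C\,\|T\sigma-T\rho\|_2^{\mu}.$$ Consequently the Hölder exponent $\frac{1}{1+2k}$ for the recovery of density operators band-limited by $k$ cannot be improved: for no $\mu>\frac1{1+2k}$ is there a constant $C\ge 0$ such that $\|\sigma-\rho\|_{\mathcal{B}_2}\leq C\|T\sigma-T\rho\|_2^{\mu}$ for all density operators $\rho,\sigma$ band-limited by $k$. -/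

import Mathlib

open MeasureTheory
open scoped ENNReal NNReal InnerProductSpace

/-- The Hilbert space `ℓ²(ℤ)` of square-summable complex sequences indexed by `ℤ`. -/
abbrev EllTwo : Type := lp (fun _ : ℤ => ℂ) 2

/-- The canonical basis vector `e_l` of `ℓ²(ℤ)`. -/
noncomputable def canonVec (l : ℤ) : EllTwo := lp.single 2 l (1 : ℂ)

/-- The matrix entry `⟨e_i, A e_j⟩` of a bounded operator `A` on `ℓ²(ℤ)`
(the inner product is conjugate-linear in its first argument). -/
noncomputable def matEntry (A : EllTwo →L[ℂ] EllTwo) (i j : ℤ) : ℂ :=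
  ⟪canonVec i, A (canonVec j)⟫_ℂ

/-- The Hilbert-Schmidt norm of a bounded operator on `ℓ²(ℤ)`, i.e. the `ℓ²(ℤ × ℤ)` norm of its
matrix; its value is `∞` if the operator is not Hilbert-Schmidt. -/
noncomputable def hsNorm (A : EllTwo →L[ℂ] EllTwo) : ℝ≥0∞ :=
  (∑' p : ℤ × ℤ, ‖matEntry A p.1 p.2‖ₑ ^ 2) ^ (1 / 2 : ℝ)

/-- Density operators: positive semidefinite (in particular self-adjoint) operators of trace one.
For a positive operator, summability of the diagonal is the trace-class condition. -/
def IsDensityOperator (ρ : EllTwo →L[ℂ] EllTwo) : Prop :=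
  ρ.IsPositive ∧ HasSum (fun l : ℤ => matEntry ρ l l) 1

/-- An operator is band-limited by `k` if all its matrix entries at distance more than `k` from
the main diagonal vanish. -/
def IsBandLimited (k : ℕ) (ρ : EllTwo →L[ℂ] EllTwo) : Prop :=
  ∀ i j : ℤ, (k : ℤ) < |i - j| → matEntry ρ i j = 0

/-- The Bessel function `J_n` of the first kind of integer order `n`, by Bessel's integral. -/
noncomputable def besselJ (n : ℤ) (x : ℝ) : ℝ :=
  (1 / Real.pi) * ∫ t in (0 : ℝ)..Real.pi, Real.cos (n * t - x * Real.sin t)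

/-- The matrix entry `e^{i(k-l)θ} J_{k-l}(2|g|)` of `U_θ` at row `k` and column `l`. -/
noncomputable def pinemCoeff (g : ℂ) (θ : ℝ) (k l : ℤ) : ℂ :=
  Complex.exp (Complex.I * (((k - l : ℤ) : ℝ) * θ : ℝ)) * (besselJ (k - l) (2 * ‖g‖) : ℂ)

section BesselFacts

instance fact_two_pi_pos : Fact (0 < 2 * Real.pi) := ⟨Real.two_pi_pos⟩

/-- The function `t ↦ exp(i x sin t)` on the circle `ℝ / 2πℤ`. -/
noncomputable def phaseFun (x : ℝ) : C(AddCircle (2 * Real.pi), ℂ) where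
  toFun t := Complex.exp (Complex.I * ((x * Real.Angle.sin t : ℝ) : ℂ))
  continuous_toFun := by
    have h : Continuous (fun t : AddCircle (2 * Real.pi) => Real.Angle.sin t) :=
      Real.Angle.continuous_sin
    fun_prop

theorem phaseFun_coe (x t : ℝ) :
    phaseFun x (t : AddCircle (2 * Real.pi)) =
      Complex.exp (Complex.I * ((x * Real.sin t : ℝ) : ℂ)) := rfl

theorem fourierCoeff_phaseFun (x : ℝ) (n : ℤ) :
    fourierCoeff (phaseFun x) n = (besselJ n x : ℂ) := by
  have hpi : (Real.pi : ℂ) ≠ 0 := by exact_mod_cast Real.pi_ne_zero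
  rw [fourierCoeff_eq_intervalIntegral _ _ (-Real.pi)]
  have e1 : ∀ t : ℝ, fourier (-n) (t : AddCircle (2 * Real.pi)) • phaseFun x t =
      Complex.exp (Complex.I * ((x * Real.sin t - n * t : ℝ) : ℂ)) := by
    intro t
    rw [fourier_coe_apply, phaseFun_coe, smul_eq_mul, ← Complex.exp_add]
    congr 1
    push_cast
    field_simp
    ring
  simp_rw [e1]
  have hc : ∀ c : ℝ, Continuous fun t : ℝ =>
      Complex.exp (Complex.I * ((c * (x * Real.sin t - n * t) : ℝ) : ℂ)) := by
    intro c; fun_prop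
  have hc1 : Continuous fun t : ℝ =>
      Complex.exp (Complex.I * ((x * Real.sin t - n * t : ℝ) : ℂ)) := by fun_prop
  have e2 : (-Real.pi + 2 * Real.pi : ℝ) = Real.pi := by ring
  rw [e2, ← intervalIntegral.integral_add_adjacent_intervals
    (hc1.intervalIntegrable (-Real.pi) 0) (hc1.intervalIntegrable 0 Real.pi)]
  have e3 : ∫ t in (-Real.pi)..0,
      Complex.exp (Complex.I * ((x * Real.sin t - n * t : ℝ) : ℂ)) =
      ∫ t in (0 : ℝ)..Real.pi,
        Complex.exp (Complex.I * ((-1 * (x * Real.sin t - n * t) : ℝ) : ℂ)) := by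
    have := intervalIntegral.integral_comp_neg (a := 0) (b := Real.pi)
      (fun t : ℝ => Complex.exp (Complex.I * ((x * Real.sin t - n * t : ℝ) : ℂ)))
    rw [neg_zero] at this
    rw [← this]
    congr 1
    ext t
    rw [Real.sin_neg]
    congr 3
    ring
  rw [e3, ← intervalIntegral.integral_add ((hc (-1)).intervalIntegrable _ _)
    (hc1.intervalIntegrable _ _)]
  have e4 : ∀ t : ℝ, Complex.exp (Complex.I * ((-1 * (x * Real.sin t - n * t) : ℝ) : ℂ)) +
      Complex.exp (Complex.I * ((x * Real.sin t - n * t : ℝ) : ℂ)) =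
      2 * ((Real.cos (n * t - x * Real.sin t) : ℝ) : ℂ) := by
    intro t
    rw [Complex.ofReal_cos, Complex.two_cos]
    congr 2 <;> push_cast <;> ring
  simp_rw [e4]
  rw [intervalIntegral.integral_const_mul, intervalIntegral.integral_ofReal, besselJ]
  rw [Complex.real_smul]
  push_cast
  field_simp

/-- The function `t ↦ exp(i x sin t) e^{ilt}` as an element of `L²` of the circle. -/
noncomputable def phaseLp (x : ℝ) (l : ℤ) :
    Lp ℂ 2 (@AddCircle.haarAddCircle (2 * Real.pi) _) :=
  ContinuousMap.toLp 2 AddCircle.haarAddCircle ℂ (phaseFun x * fourier l)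

theorem repr_phaseLp (x : ℝ) (l k : ℤ) :
    (fourierBasis.repr (phaseLp x l) : ℤ → ℂ) k = (besselJ (k - l) x : ℂ) := by
  rw [fourierBasis_repr, phaseLp, fourierCoeff_toLp, ← fourierCoeff_phaseFun]
  unfold fourierCoeff
  congr 1
  ext t
  rw [ContinuousMap.mul_apply, show (-(k - l)) = -k + l by ring, fourier_add]
  simp only [smul_eq_mul]
  ring

theorem inner_phaseLp (x : ℝ) (l m : ℤ) :
    ⟪phaseLp x l, phaseLp x m⟫_ℂ = if l = m then 1 else 0 := by
  have h := (orthonormal_iff_ite.mp (orthonormal_fourier (T := 2 * Real.pi))) l m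
  rw [← h, phaseLp, phaseLp, fourierLp, fourierLp, ContinuousMap.inner_toLp,
    ContinuousMap.inner_toLp]
  congr 1
  ext t
  have hn : phaseFun x t * (starRingEnd ℂ) (phaseFun x t) = 1 := by
    rw [Complex.mul_conj, Complex.normSq_eq_norm_sq]
    have : ‖phaseFun x t‖ = 1 := by
      change ‖Complex.exp (Complex.I * ((x * Real.Angle.sin t : ℝ) : ℂ))‖ = 1
      rw [mul_comm, Complex.norm_exp_ofReal_mul_I]
    rw [this]; simp
  rw [ContinuousMap.mul_apply, ContinuousMap.mul_apply, map_mul]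
  linear_combination (fourier m t * (starRingEnd ℂ) (fourier l t)) * hn

theorem norm_pinemCoeff (g : ℂ) (θ : ℝ) (k l : ℤ) :
    ‖pinemCoeff g θ k l‖ = ‖(fourierBasis.repr (phaseLp (2 * ‖g‖) l) : ℤ → ℂ) k‖ := by
  rw [repr_phaseLp, pinemCoeff, norm_mul, mul_comm Complex.I, Complex.norm_exp_ofReal_mul_I,
    one_mul]

theorem memlp_pinemCoeff (g : ℂ) (θ : ℝ) (l : ℤ) :
    Memℓp (fun k : ℤ => pinemCoeff g θ k l) 2 := by
  have h := lp.memℓp (fourierBasis.repr (phaseLp (2 * ‖g‖) l))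
  rw [memℓp_gen_iff (by norm_num)] at h ⊢
  simpa only [norm_pinemCoeff] using h

end BesselFacts

/-- The column `U_θ e_l = ∑_k e^{i(k-l)θ} J_{k-l}(2|g|) e_k` as a vector of `ℓ²(ℤ)`. -/
noncomputable def pinemColumn (g : ℂ) (θ : ℝ) (l : ℤ) : EllTwo :=
  ⟨fun k : ℤ => pinemCoeff g θ k l, memlp_pinemCoeff g θ l⟩

theorem orthonormal_pinemColumn (g : ℂ) (θ : ℝ) : Orthonormal ℂ (pinemColumn g θ) := by
  rw [orthonormal_iff_ite]
  intro l m
  rw [lp.inner_eq_tsum]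
  have h : ∀ k : ℤ, ⟪(pinemColumn g θ l : ℤ → ℂ) k, (pinemColumn g θ m : ℤ → ℂ) k⟫_ℂ =
      Complex.exp (Complex.I * (((l - m : ℤ) : ℝ) * θ : ℝ)) *
        ⟪(fourierBasis.repr (phaseLp (2 * ‖g‖) l) : ℤ → ℂ) k,
          (fourierBasis.repr (phaseLp (2 * ‖g‖) m) : ℤ → ℂ) k⟫_ℂ := by
    intro k
    rw [repr_phaseLp, repr_phaseLp]
    change ⟪pinemCoeff g θ k l, pinemCoeff g θ k m⟫_ℂ = _
    simp only [RCLike.inner_apply, pinemCoeff, map_mul, Complex.conj_ofReal,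
      ← Complex.exp_conj, Complex.conj_I]
    have : Complex.exp (Complex.I * (((l - m : ℤ) : ℝ) * θ : ℝ)) =
        Complex.exp (Complex.I * (((k - m : ℤ) : ℝ) * θ : ℝ)) *
          Complex.exp (-Complex.I * (((k - l : ℤ) : ℝ) * θ : ℝ)) := by
      rw [← Complex.exp_add]
      congr 1
      push_cast
      ring
    rw [this]
    ring
  simp_rw [h]
  rw [tsum_mul_left, ← lp.inner_eq_tsum, LinearIsometryEquiv.inner_map_map, inner_phaseLp]
  split_ifs with hlm
  · subst hlm; simp
  · simp

/-- The bounded operator (an isometry) `U_θ` on `ℓ²(ℤ)` with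
`U_θ e_l = ∑_k e^{i(k-l)θ} J_{k-l}(2|g|) e_k`, that is, `U_θ x = ∑_l x_l U_θ e_l`. -/
noncomputable def pinemU (g : ℂ) (θ : ℝ) : EllTwo →L[ℂ] EllTwo :=
  ((orthonormal_pinemColumn g θ).orthogonalFamily.linearIsometry).toContinuousLinearMap

theorem pinemU_canonVec (g : ℂ) (θ : ℝ) (l : ℤ) :
    pinemU g θ (canonVec l) = pinemColumn g θ l := by
  unfold pinemU canonVec
  rw [LinearIsometry.coe_toContinuousLinearMap, OrthogonalFamily.linearIsometry_apply_single]
  simp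

theorem matEntry_pinemU (g : ℂ) (θ : ℝ) (k l : ℤ) :
    matEntry (pinemU g θ) k l =
      Complex.exp (Complex.I * (((k - l : ℤ) : ℝ) * θ : ℝ)) *
        (besselJ (k - l) (2 * ‖g‖) : ℂ) := by
  rw [matEntry, pinemU_canonVec, canonVec, lp.inner_single_left]
  simp [pinemColumn, pinemCoeff]

/-- The forward operator `(Tρ)(θ, l) = ⟨e_l, U_θ ρ U_θ^* e_l⟩`. -/
noncomputable def pinemT (g : ℂ) (ρ : EllTwo →L[ℂ] EllTwo) : ℝ × ℤ → ℂ := fun q =>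
  matEntry (pinemU g q.1 ∘L ρ ∘L ContinuousLinearMap.adjoint (pinemU g q.1)) q.2 q.2

/-- The norm of `L²([-π, π] × ℤ)` (Lebesgue measure times counting measure), with value `∞` for
functions that are not square-integrable. -/
noncomputable def dataNorm (f : ℝ × ℤ → ℂ) : ℝ≥0∞ :=
  eLpNorm f 2 ((volume.restrict (Set.Icc (-Real.pi) Real.pi)).prod Measure.count)

/-! For `k ≥ 1`, the idea is to find two states whose difference lives on the `k`-th off-diagonals,
carries a slowly varying profile `a` there, and is almost invisible to `T`. On such an operator `T`
gives `2 cos(kθ)` times the convolution of `a` with `J_l J_{l-k}`, where the Bessel argument is `x =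
2|g|`. Writing `k = n - (n - k)` and applying the three-term recurrence to each term, `k J_n
J_{n-k}` becomes `x/2` times backward differences of products of the same type with offsets `k + 1`
and `k - 1`. Summation by parts moves these differences onto `a`, and the step can be repeated `k`
times before the offset can reach zero. Hence the data are bounded by a constant times the `ℓ²` norm
of the `k`-th difference of `a` (`seqNorm_besselConv_le_pow`, `dataNorm_symDiag_le`).

Take `a` to be a discrete B-spline of scale `N` with total mass one (`exists_spread_sequence`). Its
norm is at least of order `N^(-1/2)`, while its `k`-th difference is at most of order
`N^(-(k+1/2))`. Comparing exponents as `N → ∞` rules out every `μ > 1/(1+2k)`. The states are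
mixtures of the vectors `e_j ± e_{j+k}` with weights given by `a` (`pairState_sub`).

For `k = 0` no smoothing is needed: `μ > 1` already fails for nearby diagonal states, because `T` is
linear and bounded on their differences. -/

/-! ### Bessel identities -/

/-- Integrate the derivative of `sin(nt - x sin t)` over `[0, π]`; both boundary values vanish. -/
theorem besselJ_recurrence (n : ℤ) (x : ℝ) :
    n * besselJ n x = x / 2 * (besselJ (n - 1) x + besselJ (n + 1) x) := by
  have hd : ∀ t : ℝ, HasDerivAt (fun t : ℝ => Real.sin (n * t - x * Real.sin t))
      (Real.cos (n * t - x * Real.sin t) * (n - x * Real.cos t)) t := by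
    intro t
    have h := (((hasDerivAt_id t).const_mul (n : ℝ)).sub
      ((Real.hasDerivAt_sin t).const_mul x)).sin
    simpa using h
  have hI := intervalIntegral.integral_eq_sub_of_hasDerivAt (a := 0) (b := Real.pi)
    (fun t _ => hd t) (Continuous.intervalIntegrable (by fun_prop) _ _)
  simp only [Real.sin_pi, Real.sin_zero, mul_zero, sub_zero, Real.sin_int_mul_pi] at hI
  have hc : ∀ m : ℝ, Continuous fun t : ℝ => Real.cos (m * t - x * Real.sin t) := by
    intro m; fun_prop
  have hJ : x / 2 * ((∫ t in (0 : ℝ)..Real.pi, Real.cos (((n - 1 : ℤ) : ℝ) * t - x * Real.sin t)) +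
      ∫ t in (0 : ℝ)..Real.pi, Real.cos (((n + 1 : ℤ) : ℝ) * t - x * Real.sin t)) =
      n * ∫ t in (0 : ℝ)..Real.pi, Real.cos (n * t - x * Real.sin t) := by
    rw [← intervalIntegral.integral_add ((hc _).intervalIntegrable _ _)
      ((hc _).intervalIntegrable _ _), ← intervalIntegral.integral_const_mul,
      ← intervalIntegral.integral_const_mul, ← sub_eq_zero, ← neg_eq_zero, neg_sub,
      ← intervalIntegral.integral_sub, ← hI]
    · congr 1
      ext t
      have h1 : ((n - 1 : ℤ) : ℝ) * t - x * Real.sin t = (n * t - x * Real.sin t) - t := by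
        push_cast; ring
      have h2 : ((n + 1 : ℤ) : ℝ) * t - x * Real.sin t = (n * t - x * Real.sin t) + t := by
        push_cast; ring
      rw [h1, h2, Real.cos_sub (n * t - x * Real.sin t) t, Real.cos_add (n * t - x * Real.sin t) t]
      ring
    · exact Continuous.intervalIntegrable (by fun_prop) _ _
    · exact Continuous.intervalIntegrable (by fun_prop) _ _
  simp only [besselJ]
  linear_combination (-1 / Real.pi) * hJ

/-- Parseval for the unimodular function `exp(i x sin t)`, whose Fourier coefficients are the
`J_n(x)`. -/
theorem hasSum_besselJ_sq (x : ℝ) : HasSum (fun n : ℤ => besselJ n x ^ 2) 1 := by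
  have h := lp.hasSum_inner (𝕜 := ℂ) (G := fun _ : ℤ => ℂ) (fourierBasis.repr (phaseLp x 0))
    (fourierBasis.repr (phaseLp x 0))
  rw [LinearIsometryEquiv.inner_map_map, inner_phaseLp, if_pos rfl] at h
  simp only [repr_phaseLp, sub_zero, RCLike.inner_apply, Complex.conj_ofReal] at h
  rw [← Complex.hasSum_ofReal]
  simpa [sq] using h

/-! ### Norms, shifts and differences of real sequences -/

/-- The `ℓ²(ℤ)` norm of a real sequence. -/
noncomputable def seqNorm (a : ℤ → ℝ) : ℝ≥0∞ := eLpNorm a 2 Measure.count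

theorem seqNorm_sq (a : ℤ → ℝ) : seqNorm a ^ 2 = ∑' j, ENNReal.ofReal (a j ^ 2) := by
  rw [seqNorm, eLpNorm_eq_lintegral_rpow_enorm_toReal (by norm_num) (by norm_num),
    lintegral_count, ← ENNReal.rpow_natCast, ← ENNReal.rpow_mul]
  norm_num
  congr 1
  ext j
  rw [Real.enorm_eq_ofReal_abs, ← ENNReal.ofReal_pow (abs_nonneg _), sq_abs]

theorem seqNorm_sq_of_support (a : ℤ → ℝ) (s : Finset ℤ) (hs : ∀ j ∉ s, a j = 0) :
    seqNorm a ^ 2 = ENNReal.ofReal (∑ j ∈ s, a j ^ 2) := by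
  rw [seqNorm_sq, tsum_eq_sum (s := s) (by intro j hj; simp [hs j hj]),
    ENNReal.ofReal_sum_of_nonneg (fun _ _ => sq_nonneg _)]

theorem seqNorm_sub_le (a b : ℤ → ℝ) : seqNorm (a - b) ≤ seqNorm a + seqNorm b :=
  eLpNorm_sub_le (measurable_of_countable _).aestronglyMeasurable
    (measurable_of_countable _).aestronglyMeasurable (by norm_num)

theorem seqNorm_smul (c : ℝ) (a : ℤ → ℝ) : seqNorm (c • a) = ‖c‖ₑ * seqNorm a :=
  eLpNorm_const_smul _ _ _ _

theorem seqNorm_comp_equiv (a : ℤ → ℝ) (e : ℤ ≃ ℤ) : seqNorm (a ∘ e) = seqNorm a := by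
  have : seqNorm (a ∘ e) ^ 2 = seqNorm a ^ 2 := by
    rw [seqNorm_sq, seqNorm_sq]
    exact e.tsum_eq (fun j => ENNReal.ofReal (a j ^ 2))
  exact (ENNReal.pow_right_strictMono two_ne_zero).injective this

/-- The right shift on sequences. -/
noncomputable def seqShift : Module.End ℝ (ℤ → ℝ) := LinearMap.funLeft ℝ ℝ fun j => j - 1

theorem seqShift_apply (a : ℤ → ℝ) (j : ℤ) : seqShift a j = a (j - 1) := rfl

theorem seqShift_pow_apply (N : ℕ) (a : ℤ → ℝ) (j : ℤ) : (seqShift ^ N) a j = a (j - N) := by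
  induction N generalizing j with
  | zero => simp
  | succ N ih =>
    rw [pow_succ', Module.End.mul_apply, seqShift_apply, ih]
    congr 1; push_cast; ring

theorem seqNorm_seqShift_pow (N : ℕ) (a : ℤ → ℝ) : seqNorm ((seqShift ^ N) a) = seqNorm a := by
  rw [← seqNorm_comp_equiv a (Equiv.subRight (N : ℤ))]
  congr 1
  ext j
  exact seqShift_pow_apply N a j

theorem finite_support_one_sub_seqShift {a : ℤ → ℝ} (ha : a.support.Finite) :
    ((1 - seqShift : Module.End ℝ (ℤ → ℝ)) a).support.Finite := by
  refine (ha.union (ha.preimage (sub_left_injective (b := (1 : ℤ))).injOn)).subset ?_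
  intro j hj
  simp only [Set.mem_union, Set.mem_preimage, Function.mem_support]
  by_contra! h
  exact hj (by simp [seqShift_apply, h.1, h.2])

/-! ### Smoothing by the Bessel kernel -/

/-- Convolution of a sequence with the product `J_l J_{l-k}` of Bessel functions. -/
noncomputable def besselConv (x : ℝ) (k : ℤ) (a : ℤ → ℝ) (l : ℤ) : ℝ :=
  ∑' j, a j * (besselJ (l - j) x * besselJ (l - j - k) x)

theorem besselConv_eq_sum (x : ℝ) (k : ℤ) (a : ℤ → ℝ) (s : Finset ℤ) (hs : ∀ j ∉ s, a j = 0)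
    (l : ℤ) :
    besselConv x k a l = ∑ j ∈ s, a j * (besselJ (l - j) x * besselJ (l - j - k) x) :=
  tsum_eq_sum (by intro j hj; simp [hs j hj])

theorem sum_besselJ_sq_le (x : ℝ) (c : ℤ) (s : Finset ℤ) :
    ∑ j ∈ s, besselJ (c - j) x ^ 2 ≤ 1 := by
  have h := (Equiv.subLeft c).hasSum_iff.mpr (hasSum_besselJ_sq x)
  exact sum_le_hasSum s (fun _ _ => sq_nonneg _) h

/-- Cauchy–Schwarz pairs `a_j J_{l-j}` with `J_{l-j-k}`. The second factor has square sum at most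
one, and summing the first over `l` gives the squared norm of `a`. -/
theorem seqNorm_besselConv_le (x : ℝ) (k : ℤ) {a : ℤ → ℝ} (ha : a.support.Finite) :
    seqNorm (besselConv x k a) ≤ seqNorm a := by
  set s := ha.toFinset
  have hs : ∀ j ∉ s, a j = 0 := by intro j hj; simpa [s] using hj
  rw [← ENNReal.pow_le_pow_left_iff two_ne_zero, seqNorm_sq_of_support a s hs, seqNorm_sq]
  have hc : HasSum (fun l : ℤ => ∑ j ∈ s, a j ^ 2 * besselJ (l - j) x ^ 2) (∑ j ∈ s, a j ^ 2) := by
    refine hasSum_sum fun j _ => ?_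
    simpa using ((Equiv.subRight j).hasSum_iff.mpr (hasSum_besselJ_sq x)).mul_left (a j ^ 2)
  rw [← hc.tsum_eq, ENNReal.ofReal_tsum_of_nonneg
    (fun l => Finset.sum_nonneg fun j _ => by positivity) hc.summable]
  refine ENNReal.tsum_le_tsum fun l => ENNReal.ofReal_le_ofReal ?_
  rw [besselConv_eq_sum x k a s hs]
  have h1 := Finset.sum_mul_sq_le_sq_mul_sq s (fun j => a j * besselJ (l - j) x)
    (fun j => besselJ (l - k - j) x)
  have h2 := sum_besselJ_sq_le x (l - k) s
  have h3 : 0 ≤ ∑ j ∈ s, (a j * besselJ (l - j) x) ^ 2 := Finset.sum_nonneg fun _ _ => sq_nonneg _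
  have h4 : ∑ j ∈ s, a j * (besselJ (l - j) x * besselJ (l - j - k) x) =
      ∑ j ∈ s, a j * besselJ (l - j) x * besselJ (l - k - j) x :=
    Finset.sum_congr rfl fun j _ => by rw [sub_right_comm, mul_assoc]
  simp_rw [← mul_pow]
  rw [h4]
  nlinarith

theorem summable_besselConv (x : ℝ) (k l : ℤ) {a : ℤ → ℝ} (ha : a.support.Finite) :
    Summable fun j => a j * (besselJ (l - j) x * besselJ (l - j - k) x) :=
  summable_of_hasFiniteSupport (ha.subset fun j hj h => hj (by simp [h]))

theorem besselConv_one_sub_seqShift (x : ℝ) (k l : ℤ) {a : ℤ → ℝ} (ha : a.support.Finite) :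
    besselConv x k ((1 - seqShift : Module.End ℝ (ℤ → ℝ)) a) l =
      besselConv x k a l - besselConv x k a (l - 1) := by
  have h : besselConv x k a (l - 1) =
      ∑' j, a (j - 1) * (besselJ (l - j) x * besselJ (l - j - k) x) := by
    rw [besselConv, ← (Equiv.subRight (1 : ℤ)).tsum_eq]
    simp
  have hs : Summable fun j => a (j - 1) * (besselJ (l - j) x * besselJ (l - j - k) x) := by
    convert (Equiv.subRight (1 : ℤ)).summable_iff.mpr (summable_besselConv x k (l - 1) ha) using 1
    ext j
    simp
  rw [h, besselConv, besselConv, ← (summable_besselConv x k l ha).tsum_sub hs]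
  congr 1
  ext j
  simp [seqShift_apply]
  ring

/-- The smoothing step: apply the recurrence to both terms of `k = (l - j) - (l - j - k)`. The four
products group into two backward differences in `l`, which pass to `a` by translation invariance. -/
theorem mul_besselConv (x : ℝ) (k l : ℤ) {a : ℤ → ℝ} (ha : a.support.Finite) :
    k * besselConv x k a l =
      x / 2 * (besselConv x (k + 1) ((1 - seqShift : Module.End ℝ (ℤ → ℝ)) a) (l + 1) -
        besselConv x (k - 1) ((1 - seqShift : Module.End ℝ (ℤ → ℝ)) a) l) := by
  rw [besselConv_one_sub_seqShift x _ _ ha, besselConv_one_sub_seqShift x _ _ ha,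
    add_sub_cancel_right]
  simp only [besselConv]
  have S := fun k l => summable_besselConv x k l ha
  rw [← (S _ _).tsum_sub (S _ _), ← (S _ _).tsum_sub (S _ _),
    ← ((S _ _).sub (S _ _)).tsum_sub ((S _ _).sub (S _ _)), ← tsum_mul_left, ← tsum_mul_left]
  congr 1
  ext j
  have r1 := besselJ_recurrence (l - j) x
  have r2 := besselJ_recurrence (l - j - k) x
  rw [show l + 1 - j - (k + 1) = l - j - k by ring, show l - j - (k - 1) = l - j - k + 1 by ring,
    show l - 1 - j - (k - 1) = l - j - k by ring, show l - 1 - j = l - j - 1 by ring,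
    show l + 1 - j = l - j + 1 by ring, show l - j - (k + 1) = l - j - k - 1 by ring]
  push_cast at r1 r2
  linear_combination a j * besselJ (l - j - k) x * r1 - a j * besselJ (l - j) x * r2

/-- Each smoothing step trades the offset `k` for `k ± 1`, so the induction on `m` must cover all
offsets. The condition `m ≤ k` keeps the divisor nonzero throughout. -/
theorem seqNorm_besselConv_le_pow (x : ℝ) (m k : ℕ) (hmk : m ≤ k) {a : ℤ → ℝ}
    (ha : a.support.Finite) :
    seqNorm (besselConv x k a) ≤
      ‖x‖ₑ ^ m * seqNorm (((1 - seqShift : Module.End ℝ (ℤ → ℝ)) ^ m) a) := by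
  induction m generalizing k a with
  | zero => simpa using seqNorm_besselConv_le x k ha
  | succ m ih =>
    set b := (1 - seqShift : Module.End ℝ (ℤ → ℝ)) a with hb
    have hbf : b.support.Finite := finite_support_one_sub_seqShift ha
    have hk : (0 : ℝ) < k := by exact_mod_cast (by omega : 0 < k)
    have e : besselConv x k a = (x / (2 * k)) • (besselConv x ((k + 1 : ℕ) : ℤ) b ∘
        Equiv.addRight (1 : ℤ) - besselConv x ((k - 1 : ℕ) : ℤ) b) := by
      ext l
      have := mul_besselConv x k l ha
      rw [← hb] at this
      push_cast [show 1 ≤ k by omega] at this ⊢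
      simp only [Pi.smul_apply, Pi.sub_apply, Function.comp_apply, Equiv.coe_addRight, smul_eq_mul]
      rw [show x / (2 * k) * (besselConv x (k + 1) b (l + 1) - besselConv x (k - 1) b l)
        = (k * besselConv x k a l) / k by rw [this]; field_simp]
      field_simp
    rw [e, seqNorm_smul, pow_succ _ m, pow_succ, Module.End.mul_apply, ← hb]
    set M := ‖x‖ₑ ^ m * seqNorm (((1 - seqShift : Module.End ℝ (ℤ → ℝ)) ^ m) b)
    have h1 := ih (k + 1) (by omega) hbf
    have h2 := ih (k - 1) (by omega) hbf
    -- The factor two counts the offsets `k + 1` and `k - 1`; the gain `1 / k` is discarded.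
    have h3 : ‖x / (2 * k)‖ₑ * 2 ≤ ‖x‖ₑ := by
      rw [show (2 : ℝ≥0∞) = ‖(2 : ℝ)‖ₑ by simp [Real.enorm_eq_ofReal_abs], ← enorm_mul,
        Real.enorm_eq_ofReal_abs, Real.enorm_eq_ofReal_abs]
      refine ENNReal.ofReal_le_ofReal ?_
      rw [show x / (2 * k) * 2 = x / k by field_simp, abs_div, abs_of_pos hk]
      exact div_le_self (abs_nonneg _) (by exact_mod_cast (by omega : 1 ≤ k))
    calc _ ≤ ‖x / (2 * k)‖ₑ * (M + M) := by
          gcongr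
          refine (seqNorm_sub_le _ _).trans (add_le_add ?_ h2)
          rw [seqNorm_comp_equiv]
          exact h1
      _ = (‖x / (2 * k)‖ₑ * 2) * M := by ring
      _ ≤ ‖x‖ₑ * M := by gcongr
      _ = _ := by ring

/-! ### Matrix units and the forward operator on a pair of off-diagonals -/

theorem canonVec_apply (i j : ℤ) : (canonVec i : ℤ → ℂ) j = if j = i then 1 else 0 := by
  rw [canonVec, lp.single_apply, Pi.single_apply]

theorem inner_canonVec_left (i : ℤ) (v : EllTwo) : ⟪canonVec i, v⟫_ℂ = (v : ℤ → ℂ) i := by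
  rw [canonVec, lp.inner_single_left]
  simp

theorem inner_canonVec_right (i : ℤ) (v : EllTwo) :
    ⟪v, canonVec i⟫_ℂ = (starRingEnd ℂ) ((v : ℤ → ℂ) i) := by
  rw [← inner_conj_symm, inner_canonVec_left]

theorem matEntry_rankOne (u v : EllTwo) (i j : ℤ) :
    matEntry (InnerProductSpace.rankOne ℂ u v) i j =
      (u : ℤ → ℂ) i * (starRingEnd ℂ) ((v : ℤ → ℂ) j) := by
  rw [matEntry, InnerProductSpace.rankOne_apply, inner_smul_right, inner_canonVec_left,
    inner_canonVec_right, mul_comm]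

theorem matEntry_add (A B : EllTwo →L[ℂ] EllTwo) (i j : ℤ) :
    matEntry (A + B) i j = matEntry A i j + matEntry B i j := by
  simp [matEntry]

theorem matEntry_smul (c : ℂ) (A : EllTwo →L[ℂ] EllTwo) (i j : ℤ) :
    matEntry (c • A) i j = c * matEntry A i j := by
  simp [matEntry]

theorem matEntry_sum {ι : Type*} (s : Finset ι) (A : ι → EllTwo →L[ℂ] EllTwo) (i j : ℤ) :
    matEntry (∑ n ∈ s, A n) i j = ∑ n ∈ s, matEntry (A n) i j := by
  simp [matEntry]

/-- The matrix unit with a single entry `1` at position `(i, j)`. -/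
noncomputable def matUnit (i j : ℤ) : EllTwo →L[ℂ] EllTwo :=
  InnerProductSpace.rankOne ℂ (canonVec i) (canonVec j)

theorem matEntry_matUnit (i j p q : ℤ) :
    matEntry (matUnit i j) p q = if p = i ∧ q = j then 1 else 0 := by
  rw [matUnit, matEntry_rankOne, canonVec_apply, canonVec_apply]
  split_ifs <;> simp_all

theorem hasSum_matEntry_matUnit (i j : ℤ) :
    HasSum (fun l => matEntry (matUnit i j) l l) (if i = j then 1 else 0) := by
  simp_rw [matEntry_matUnit]
  convert hasSum_ite_eq i (if i = j then (1 : ℂ) else 0) using 2 with l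
  split_ifs <;> simp_all

theorem pinemT_add (g : ℂ) (A B : EllTwo →L[ℂ] EllTwo) :
    pinemT g (A + B) = pinemT g A + pinemT g B := by
  ext q
  simp [pinemT, matEntry]

theorem pinemT_sub (g : ℂ) (A B : EllTwo →L[ℂ] EllTwo) :
    pinemT g (A - B) = pinemT g A - pinemT g B := by
  ext q
  simp [pinemT, matEntry]

theorem pinemT_smul (g : ℂ) (c : ℂ) (A : EllTwo →L[ℂ] EllTwo) :
    pinemT g (c • A) = c • pinemT g A := by
  ext q
  simp [pinemT, matEntry]

theorem pinemT_sum {ι : Type*} (g : ℂ) (s : Finset ι) (A : ι → EllTwo →L[ℂ] EllTwo) (q : ℝ × ℤ) :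
    pinemT g (∑ n ∈ s, A n) q = ∑ n ∈ s, pinemT g (A n) q := by
  simp [pinemT, matEntry]

theorem pinemT_matUnit (g : ℂ) (i j : ℤ) (q : ℝ × ℤ) :
    pinemT g (matUnit i j) q =
      pinemCoeff g q.1 q.2 i * (starRingEnd ℂ) (pinemCoeff g q.1 q.2 j) := by
  rw [pinemT, matUnit, InnerProductSpace.rankOne_comp, InnerProductSpace.comp_rankOne,
    ContinuousLinearMap.adjoint_adjoint, matEntry_rankOne, pinemU_canonVec, pinemU_canonVec]
  rfl

/-- The self-adjoint operator with the real sequence `a` on its `k`-th lower and upper diagonals;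
only the indices in `s` are used. -/
noncomputable def symDiag (k : ℕ) (s : Finset ℤ) (a : ℤ → ℝ) : EllTwo →L[ℂ] EllTwo :=
  ∑ j ∈ s, (a j : ℂ) • (matUnit (j + k) j + matUnit j (j + k))

/-- The phases of the two matrix units at each `j` are `e^{-ikθ}` and `e^{ikθ}`, independent of `j`
and `l`, so they factor out as `2 cos(kθ)`. -/
theorem pinemT_symDiag (g : ℂ) (k : ℕ) (s : Finset ℤ) (a : ℤ → ℝ) (hs : ∀ j ∉ s, a j = 0)
    (q : ℝ × ℤ) :
    pinemT g (symDiag k s a) q =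
      ((2 * Real.cos (k * q.1) * besselConv (2 * ‖g‖) k a q.2 : ℝ) : ℂ) := by
  rw [symDiag, pinemT_sum, besselConv_eq_sum _ _ _ s hs, Finset.mul_sum, Complex.ofReal_sum]
  refine Finset.sum_congr rfl fun j _ => ?_
  rw [pinemT_smul, pinemT_add]
  simp only [Pi.smul_apply, Pi.add_apply, pinemT_matUnit, pinemCoeff, map_mul,
    Complex.conj_ofReal, ← Complex.exp_conj, Complex.conj_I, smul_eq_mul]
  rw [show q.2 - (j + k) = q.2 - j - k by ring]
  set J₁ := besselJ (q.2 - j) (2 * ‖g‖)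
  set J₂ := besselJ (q.2 - j - k) (2 * ‖g‖)
  have e1 : Complex.exp (Complex.I * (((q.2 - j - k : ℤ) : ℝ) * q.1 : ℝ)) *
      Complex.exp (-Complex.I * (((q.2 - j : ℤ) : ℝ) * q.1 : ℝ)) =
      Complex.exp (-(k * q.1 : ℂ) * Complex.I) := by
    rw [← Complex.exp_add]; congr 1; push_cast; ring
  have e2 : Complex.exp (Complex.I * (((q.2 - j : ℤ) : ℝ) * q.1 : ℝ)) *
      Complex.exp (-Complex.I * (((q.2 - j - k : ℤ) : ℝ) * q.1 : ℝ)) =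
      Complex.exp ((k * q.1 : ℂ) * Complex.I) := by
    rw [← Complex.exp_add]; congr 1; push_cast; ring
  have e3 := Complex.two_cos (k * q.1 : ℂ)
  push_cast at e1 e2 ⊢
  linear_combination (a j * J₁ * J₂ : ℂ) * (e1 + e2 - e3)

theorem dataNorm_le_of_norm_le (f : ℝ × ℤ → ℂ) (h : ℤ → ℝ)
    (hf : ∀ q, ‖f q‖ ≤ |h q.2|) :
    dataNorm f ≤ (2 * ENNReal.ofReal Real.pi) ^ (1 / 2 : ℝ) * seqNorm h := by
  rw [dataNorm, seqNorm, eLpNorm_eq_lintegral_rpow_enorm_toReal (by norm_num) (by norm_num),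
    eLpNorm_eq_lintegral_rpow_enorm_toReal (by norm_num) (by norm_num),
    ENNReal.toReal_ofNat, ← ENNReal.mul_rpow_of_nonneg _ _ (by norm_num)]
  refine ENNReal.rpow_le_rpow ?_ (by norm_num)
  calc _ ≤ ∫⁻ q : ℝ × ℤ, ‖h q.2‖ₑ ^ (2 : ℝ)
        ∂((volume.restrict (Set.Icc (-Real.pi) Real.pi)).prod Measure.count) := by
        refine lintegral_mono fun q => ?_
        refine ENNReal.rpow_le_rpow ?_ (by norm_num)
        rw [enorm_le_iff_norm_le, Real.norm_eq_abs]
        exact hf q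
    -- This direction of Tonelli requires no measurability.
    _ ≤ _ := lintegral_prod_le _
    _ = _ := by
        dsimp only
        rw [lintegral_const, Measure.restrict_apply_univ, Real.volume_Icc, sub_neg_eq_add,
          ← two_mul, ENNReal.ofReal_mul (by norm_num), mul_comm]
        simp

theorem dataNorm_symDiag_le (g : ℂ) (k : ℕ) (s : Finset ℤ) (a : ℤ → ℝ) (hs : ∀ j ∉ s, a j = 0) :
    dataNorm (pinemT g (symDiag k s a)) ≤
      (2 * ENNReal.ofReal Real.pi) ^ (1 / 2 : ℝ) * (2 * ‖2 * ‖g‖‖ₑ ^ k) *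
        seqNorm (((1 - seqShift : Module.End ℝ (ℤ → ℝ)) ^ k) a) := by
  have ha : a.support.Finite := s.finite_toSet.subset fun j hj => by
    by_contra h; exact hj (hs j h)
  refine (dataNorm_le_of_norm_le _ ((2 : ℝ) • besselConv (2 * ‖g‖) k a) fun q => ?_).trans ?_
  · rw [pinemT_symDiag g k s a hs, Complex.norm_real, Real.norm_eq_abs, Pi.smul_apply,
      smul_eq_mul, abs_mul, abs_mul, abs_mul]
    have := Real.abs_cos_le_one (k * q.1)
    gcongr
    nlinarith [abs_nonneg (2 : ℝ)]
  · rw [seqNorm_smul, mul_assoc, mul_assoc]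
    gcongr
    · simp [Real.enorm_eq_ofReal_abs]
    · exact seqNorm_besselConv_le_pow _ k k le_rfl ha

theorem seqNorm_le_hsNorm_symDiag (k : ℕ) (s : Finset ℤ) (a : ℤ → ℝ) (hs : ∀ j ∉ s, a j = 0) :
    seqNorm a ≤ hsNorm (symDiag k s a) := by
  have hentry : ∀ j, ‖a j‖ₑ ^ 2 ≤ ‖matEntry (symDiag k s a) (j + k) j‖ₑ ^ 2 := by
    intro j
    -- For `k = 0` the lower and upper diagonals coincide and the entry doubles.
    have e : matEntry (symDiag k s a) (j + k) j = if k = 0 then (2 * a j : ℂ) else a j := by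
      rw [symDiag, matEntry_sum, Finset.sum_eq_single j]
      · rw [matEntry_smul, matEntry_add, matEntry_matUnit, matEntry_matUnit]
        rcases eq_or_ne k 0 with rfl | hk
        · simp [mul_comm, one_add_one_eq_two]
        · simp [hk]
      · intro i _ hij
        rw [matEntry_smul, matEntry_add, matEntry_matUnit, matEntry_matUnit, if_neg, if_neg]
        · simp
        · omega
        · omega
      · intro hj; rw [matEntry_smul, hs j hj, Complex.ofReal_zero, zero_mul]
    rw [e]
    gcongr
    rw [enorm_le_iff_norm_le]
    split_ifs
    · rw [norm_mul, Complex.norm_real]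
      norm_num
      linarith [abs_nonneg (a j)]
    · rw [Complex.norm_real]
  rw [hsNorm, seqNorm, eLpNorm_eq_lintegral_rpow_enorm_toReal (by norm_num) (by norm_num),
    lintegral_count, ENNReal.toReal_ofNat]
  refine ENNReal.rpow_le_rpow ?_ (by norm_num)
  simp_rw [ENNReal.rpow_ofNat]
  refine (ENNReal.tsum_le_tsum hentry).trans ?_
  have hinj : Function.Injective (fun j : ℤ => ((j + k, j) : ℤ × ℤ)) :=
    fun i j h => (Prod.ext_iff.mp h).2
  exact ENNReal.tsum_comp_le_tsum_of_injective hinj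
    (fun p : ℤ × ℤ => ‖matEntry (symDiag k s a) p.1 p.2‖ₑ ^ 2)

/-! ### Discrete B-splines -/

/-- The indicator sequence of the integer interval `[0, N)`. -/
noncomputable def boxSeq (N : ℕ) : ℤ → ℝ := fun j => if j ∈ Finset.Ico (0 : ℤ) N then 1 else 0

/-- Convolution with the indicator sequence of `[0, N)`. -/
noncomputable def boxOp (N : ℕ) : Module.End ℝ (ℤ → ℝ) := ∑ i ∈ Finset.range N, seqShift ^ i

theorem boxOp_apply (N : ℕ) (a : ℤ → ℝ) (j : ℤ) :
    boxOp N a j = ∑ i ∈ Finset.range N, a (j - i) := by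
  simp [boxOp, LinearMap.sum_apply, Finset.sum_apply, seqShift_pow_apply]

/-- The discrete B-spline obtained by convolving `k + 1` indicator sequences of `[0, N)`. -/
noncomputable def splineSeq (N k : ℕ) : ℤ → ℝ := (boxOp N ^ k) (boxSeq N)

theorem splineSeq_succ (N k : ℕ) : splineSeq N (k + 1) = boxOp N (splineSeq N k) := by
  rw [splineSeq, pow_succ', Module.End.mul_apply, splineSeq]

theorem splineSeq_nonneg (N k : ℕ) (j : ℤ) : 0 ≤ splineSeq N k j := by
  induction k generalizing j with
  | zero =>
    simp only [splineSeq, pow_zero, Module.End.one_apply, boxSeq]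
    split_ifs <;> norm_num
  | succ k ih =>
    rw [splineSeq_succ, boxOp_apply]
    exact Finset.sum_nonneg fun i _ => ih _

theorem splineSeq_eq_zero (N k : ℕ) (j : ℤ) (hj : j ∉ Finset.Ico (0 : ℤ) ((k + 1) * N : ℕ)) :
    splineSeq N k j = 0 := by
  induction k generalizing j with
  | zero =>
    simp only [splineSeq, pow_zero, Module.End.one_apply, boxSeq]
    exact if_neg (by simpa using hj)
  | succ k ih =>
    rw [splineSeq_succ, boxOp_apply]
    refine Finset.sum_eq_zero fun i hi => ih _ ?_
    rw [Finset.mem_range] at hi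
    rw [Finset.mem_Ico] at hj ⊢
    push_cast at hj ⊢
    intro h
    have hi' : (i : ℤ) < N := by exact_mod_cast hi
    exact hj ⟨by linarith [h.1], by linarith [h.2]⟩

theorem hasSum_splineSeq (N k : ℕ) : HasSum (splineSeq N k) ((N : ℝ) ^ (k + 1)) := by
  induction k with
  | zero =>
    have h : HasSum (boxSeq N) (∑ j ∈ Finset.Ico (0 : ℤ) N, boxSeq N j) :=
      hasSum_sum_of_ne_finset_zero fun j hj => if_neg hj
    rw [Finset.sum_congr rfl (fun j hj => show boxSeq N j = 1 from if_pos hj)] at h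
    simpa [splineSeq] using h
  | succ k ih =>
    have h : HasSum (fun j => ∑ i ∈ Finset.range N, splineSeq N k (j - i))
        (∑ _i ∈ Finset.range N, (N : ℝ) ^ (k + 1)) :=
      hasSum_sum fun i _ => (Equiv.subRight (i : ℤ)).hasSum_iff.mpr ih
    rw [Finset.sum_const, Finset.card_range, nsmul_eq_mul, ← pow_succ'] at h
    rw [splineSeq_succ]
    exact h.congr_fun fun j => boxOp_apply N _ j

theorem sum_splineSeq (N k : ℕ) :
    ∑ j ∈ Finset.Ico (0 : ℤ) ((k + 1) * N : ℕ), splineSeq N k j = (N : ℝ) ^ (k + 1) :=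
  (hasSum_sum_of_ne_finset_zero fun j hj => splineSeq_eq_zero N k j hj).unique
    (hasSum_splineSeq N k)

/-- Each difference `1 - S` cancels one box by the geometric sum `(1 - S)(1 + S + ⋯ + S^(N-1)) = 1 -
S^N`. With `k + 1` boxes, exactly one remains. -/
theorem one_sub_seqShift_pow_splineSeq (N k : ℕ) :
    ((1 - seqShift : Module.End ℝ (ℤ → ℝ)) ^ k) (splineSeq N k) =
      ((1 - seqShift ^ N : Module.End ℝ (ℤ → ℝ)) ^ k) (boxSeq N) := by
  have hc : Commute (1 - seqShift : Module.End ℝ (ℤ → ℝ)) (boxOp N) :=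
    Commute.sum_right _ _ _ fun i _ =>
      ((Commute.one_left _).sub_left (Commute.refl seqShift)).pow_right i
  rw [splineSeq, ← Module.End.mul_apply, ← hc.mul_pow, boxOp, mul_neg_geom_sum]

theorem seqNorm_one_sub_seqShift_pow_le (N k : ℕ) (a : ℤ → ℝ) :
    seqNorm (((1 - seqShift ^ N : Module.End ℝ (ℤ → ℝ)) ^ k) a) ≤ 2 ^ k * seqNorm a := by
  induction k with
  | zero => simp
  | succ k ih =>
    rw [pow_succ', Module.End.mul_apply, LinearMap.sub_apply, Module.End.one_apply]
    refine (seqNorm_sub_le _ _).trans ?_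
    rw [seqNorm_seqShift_pow, ← two_mul, pow_succ', mul_assoc]
    gcongr

theorem seqNorm_boxSeq (N : ℕ) : seqNorm (boxSeq N) = ENNReal.ofReal ((N : ℝ) ^ (1 / 2 : ℝ)) := by
  apply (ENNReal.pow_right_strictMono two_ne_zero).injective
  beta_reduce
  rw [seqNorm_sq_of_support (boxSeq N) (Finset.Ico 0 N) (fun j hj => if_neg hj),
    ← ENNReal.ofReal_pow (by positivity), ← Real.rpow_natCast, ← Real.rpow_mul (by positivity)]
  congr 1
  rw [Finset.sum_congr rfl (fun j hj => by rw [boxSeq, if_pos hj])]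
  simp

/-- The witness is the B-spline divided by its mass `N^(k+1)`. Its `k`-th difference is a bounded
combination of translates of one box, of norm `N^(1/2)`, divided by that mass. -/
theorem exists_spread_sequence (k N : ℕ) (hN : 0 < N) :
    ∃ (s : Finset ℤ) (a : ℤ → ℝ), (∀ j ∉ s, a j = 0) ∧ (∀ j, 0 ≤ a j) ∧ ∑ j ∈ s, a j = 1 ∧
      ENNReal.ofReal (((k : ℝ) + 1) ^ (-(1 / 2) : ℝ) * (N : ℝ) ^ (-(1 / 2) : ℝ)) ≤ seqNorm a ∧
      seqNorm (((1 - seqShift : Module.End ℝ (ℤ → ℝ)) ^ k) a) ≤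
        2 ^ k * ENNReal.ofReal ((N : ℝ) ^ (-(k + 1 / 2) : ℝ)) := by
  have hN' : (0 : ℝ) < N := by exact_mod_cast hN
  set s := Finset.Ico (0 : ℤ) ((k + 1) * N : ℕ) with hs
  set a : ℤ → ℝ := ((N : ℝ) ^ (k + 1))⁻¹ • splineSeq N k with ha
  have hsup : ∀ j ∉ s, a j = 0 := fun j hj => by
    simp [ha, splineSeq_eq_zero N k j hj]
  have hsum : ∑ j ∈ s, a j = 1 := by
    simp only [ha, Pi.smul_apply, smul_eq_mul]
    rw [← Finset.mul_sum, sum_splineSeq, inv_mul_cancel₀ (by positivity)]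
  refine ⟨s, a, hsup, fun j => mul_nonneg (by positivity) (splineSeq_nonneg N k j), hsum, ?_, ?_⟩
  · rw [← ENNReal.pow_le_pow_left_iff two_ne_zero, seqNorm_sq_of_support a s hsup,
      ← ENNReal.ofReal_pow (by positivity)]
    refine ENNReal.ofReal_le_ofReal ?_
    -- Unit mass on `(k + 1) N` points forces the lower bound by Cauchy–Schwarz.
    have h := sq_sum_le_card_mul_sum_sq (s := s) (f := a)
    have hcard : (s.card : ℝ) = (k + 1) * N := by
      rw [hs, Int.card_Ico, sub_zero, Int.toNat_natCast]; push_cast; ring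
    rw [hsum, hcard, one_pow] at h
    rw [← Real.mul_rpow (by positivity) (by positivity), ← Real.rpow_natCast,
      ← Real.rpow_mul (by positivity)]
    norm_num
    rw [Real.rpow_neg_one, inv_le_iff_one_le_mul₀' (by positivity)]
    exact h
  · rw [ha, map_smul, one_sub_seqShift_pow_splineSeq, seqNorm_smul]
    refine (mul_le_mul_right (seqNorm_one_sub_seqShift_pow_le N k _) _).trans (le_of_eq ?_)
    rw [seqNorm_boxSeq, mul_left_comm, Real.enorm_eq_ofReal (by positivity),
      ← ENNReal.ofReal_mul (by positivity), ← Real.rpow_natCast, ← Real.rpow_neg hN'.le,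
      ← Real.rpow_add hN']
    congr 3
    push_cast
    ring

/-! ### The competing states -/

theorem isPositive_matUnit_self (i : ℤ) : (matUnit i i).IsPositive :=
  InnerProductSpace.isPositive_rankOne_self _

/-- The mixture with weights `a j / 2` of the projections onto the vectors `e_j + ε e_{j+k}`. -/
noncomputable def pairState (k : ℕ) (s : Finset ℤ) (a : ℤ → ℝ) (ε : ℝ) : EllTwo →L[ℂ] EllTwo :=
  ∑ j ∈ s, ((a j / 2 : ℝ) : ℂ) • InnerProductSpace.rankOne ℂ
    (canonVec j + (ε : ℂ) • canonVec (j + k)) (canonVec j + (ε : ℂ) • canonVec (j + k))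

theorem rankOne_pair (i j : ℤ) (ε : ℝ) (hε : ε ^ 2 = 1) :
    InnerProductSpace.rankOne ℂ (canonVec i + (ε : ℂ) • canonVec j)
      (canonVec i + (ε : ℂ) • canonVec j) =
      (matUnit i i + matUnit j j) + (ε : ℂ) • (matUnit j i + matUnit i j) := by
  have h : (ε : ℂ) * ε = 1 := by rw [← sq]; exact_mod_cast hε
  ext1 x
  simp only [matUnit, InnerProductSpace.rankOne_apply, add_apply,
    smul_apply, inner_add_left, inner_smul_left, Complex.conj_ofReal,
    smul_add, smul_smul]
  set A := ⟪canonVec i, x⟫_ℂ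
  set B := ⟪canonVec j, x⟫_ℂ
  rw [show (A + ε * B) * ε = ε * A + B by linear_combination B * h, add_smul, add_smul]
  abel

/-- The diagonal parts do not depend on the sign `ε` and cancel. -/
theorem pairState_sub (k : ℕ) (s : Finset ℤ) (a : ℤ → ℝ) :
    pairState k s a 1 - pairState k s a (-1) = symDiag k s a := by
  rw [pairState, pairState, symDiag, ← Finset.sum_sub_distrib]
  refine Finset.sum_congr rfl fun j _ => ?_
  rw [rankOne_pair _ _ _ (by norm_num), rankOne_pair _ _ _ (by norm_num), ← smul_sub,
    add_sub_add_left_eq_sub, ← sub_smul, smul_smul]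
  congr 1
  push_cast
  ring

/-- Since `k ≠ 0`, the vectors `e_j` and `e_{j+k}` are orthogonal, so each rank-one term has trace
two, offset by the weight `a j / 2`. -/
theorem isDensityOperator_pairState {k : ℕ} (hk : k ≠ 0) (s : Finset ℤ) (a : ℤ → ℝ)
    (ha : ∀ j, 0 ≤ a j) (hsum : ∑ j ∈ s, a j = 1) (ε : ℝ) (hε : ε ^ 2 = 1) :
    IsDensityOperator (pairState k s a ε) := by
  constructor
  · refine ContinuousLinearMap.isPositive_sum s fun j _ =>
      (InnerProductSpace.isPositive_rankOne_self _).smul_of_nonneg ?_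
    rw [Complex.zero_le_real]
    exact div_nonneg (ha j) zero_le_two
  · simp_rw [pairState, matEntry_sum, matEntry_smul]
    rw [← Complex.ofReal_one, ← hsum, Complex.ofReal_sum]
    refine hasSum_sum fun j _ => ?_
    simp_rw [rankOne_pair _ _ _ hε, matEntry_add, matEntry_smul, matEntry_add]
    convert ((((hasSum_matEntry_matUnit j j).add (hasSum_matEntry_matUnit (j + k) (j + k))).add
      (((hasSum_matEntry_matUnit (j + k) j).add (hasSum_matEntry_matUnit j (j + k))).mul_left
        (ε : ℂ))).mul_left ((a j / 2 : ℝ) : ℂ)) using 1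
    · rfl
    · simp [hk]
      ring

theorem isBandLimited_pairState (k : ℕ) (s : Finset ℤ) (a : ℤ → ℝ) (ε : ℝ) (hε : ε ^ 2 = 1) :
    IsBandLimited k (pairState k s a ε) := by
  intro p q hpq
  rw [pairState, matEntry_sum]
  refine Finset.sum_eq_zero fun j _ => ?_
  rw [rankOne_pair _ _ _ hε, matEntry_smul, matEntry_add, matEntry_smul, matEntry_add,
    matEntry_add, matEntry_matUnit, matEntry_matUnit, matEntry_matUnit, matEntry_matUnit,
    if_neg, if_neg, if_neg, if_neg]
  · simp
  all_goals
    rintro ⟨hp, hq⟩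
    rcases abs_cases (p - q) with h | h <;> omega

/-! ### Scaling argument and conclusion -/

/-- Because `p < q μ`, the bound `C D^μ N^(-qμ)` falls below `c N^(-p)` for large `N`. -/
theorem exists_density_of_scaling (g : ℂ) (k : ℕ) {μ c p q : ℝ} {D : ℝ≥0∞} (hc : 0 < c)
    (hD : D ≠ ⊤) (hμ : 0 < μ) (hpq : p < q * μ)
    (h : ∀ N : ℕ, 0 < N → ∃ ρ σ : EllTwo →L[ℂ] EllTwo, IsDensityOperator ρ ∧
      IsDensityOperator σ ∧ IsBandLimited k ρ ∧ IsBandLimited k σ ∧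
      ENNReal.ofReal (c * (N : ℝ) ^ (-p)) ≤ hsNorm (σ - ρ) ∧
      dataNorm (pinemT g σ - pinemT g ρ) ≤ D * ENNReal.ofReal ((N : ℝ) ^ (-q))) (C : ℝ≥0) :
    ∃ ρ σ : EllTwo →L[ℂ] EllTwo, IsDensityOperator ρ ∧ IsDensityOperator σ ∧
      IsBandLimited k ρ ∧ IsBandLimited k σ ∧
      (C : ℝ≥0∞) * dataNorm (pinemT g σ - pinemT g ρ) ^ μ < hsNorm (σ - ρ) := by
  set K : ℝ≥0∞ := C * D ^ μ with hK
  have hKt : K ≠ ⊤ := ENNReal.mul_ne_top ENNReal.coe_ne_top (ENNReal.rpow_ne_top_of_nonneg hμ.le hD)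
  have ht : Filter.Tendsto (fun N : ℕ => K.toReal * (N : ℝ) ^ (-(q * μ - p))) Filter.atTop
      (nhds (K.toReal * 0)) :=
    ((tendsto_rpow_neg_atTop (sub_pos.mpr hpq)).comp tendsto_natCast_atTop_atTop).const_mul _
  rw [mul_zero] at ht
  obtain ⟨N, hN, hN0⟩ := ((ht.eventually_lt_const hc).and (Filter.eventually_gt_atTop 0)).exists
  have hN' : (0 : ℝ) < N := by exact_mod_cast hN0
  obtain ⟨ρ, σ, h1, h2, h3, h4, h5, h6⟩ := h N hN0
  refine ⟨ρ, σ, h1, h2, h3, h4, lt_of_lt_of_le ?_ h5⟩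
  calc _ ≤ (C : ℝ≥0∞) * (D * ENNReal.ofReal ((N : ℝ) ^ (-q))) ^ μ := by gcongr
    _ = ENNReal.ofReal (K.toReal * (N : ℝ) ^ (-(q * μ))) := by
        rw [ENNReal.mul_rpow_of_nonneg _ _ hμ.le, ← mul_assoc, ← hK,
          ENNReal.ofReal_mul ENNReal.toReal_nonneg, ENNReal.ofReal_toReal hKt,
          ENNReal.ofReal_rpow_of_pos (by positivity), ← Real.rpow_mul hN'.le, neg_mul]
    _ < _ := by
        rw [ENNReal.ofReal_lt_ofReal_iff (by positivity)]
        rw [show -(q * μ) = -(q * μ - p) + -p by ring, Real.rpow_add hN', ← mul_assoc]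
        gcongr

theorem exists_density_pair_of_pos (g : ℂ) {k : ℕ} (hk : k ≠ 0) (N : ℕ) (hN : 0 < N) :
    ∃ ρ σ : EllTwo →L[ℂ] EllTwo, IsDensityOperator ρ ∧
      IsDensityOperator σ ∧ IsBandLimited k ρ ∧ IsBandLimited k σ ∧
      ENNReal.ofReal (((k : ℝ) + 1) ^ (-(1 / 2) : ℝ) * (N : ℝ) ^ (-(1 / 2) : ℝ)) ≤
        hsNorm (σ - ρ) ∧
      dataNorm (pinemT g σ - pinemT g ρ) ≤
        ((2 * ENNReal.ofReal Real.pi) ^ (1 / 2 : ℝ) * (2 * ‖2 * ‖g‖‖ₑ ^ k) * 2 ^ k) *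
          ENNReal.ofReal ((N : ℝ) ^ (-(k + 1 / 2) : ℝ)) := by
  obtain ⟨s, a, hs, ha, hsum, hlow, hup⟩ := exists_spread_sequence k N hN
  refine ⟨pairState k s a (-1), pairState k s a 1,
    isDensityOperator_pairState hk s a ha hsum _ (by norm_num),
    isDensityOperator_pairState hk s a ha hsum _ (by norm_num),
    isBandLimited_pairState k s a _ (by norm_num), isBandLimited_pairState k s a _ (by norm_num),
    ?_, ?_⟩
  · rw [pairState_sub]
    exact hlow.trans (seqNorm_le_hsNorm_symDiag k s a hs)
  · rw [← pinemT_sub, pairState_sub]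
    refine (dataNorm_symDiag_le g k s a hs).trans ?_
    rw [mul_assoc _ (2 ^ k)]
    gcongr

/-- Moving mass `1 / N` from `e_0` to `e_1` changes state and data linearly in `1 / N`, which
defeats every exponent above one. -/
theorem exists_diagonal_density_pair (g : ℂ) (N : ℕ) (hN : 0 < N) :
    ∃ ρ σ : EllTwo →L[ℂ] EllTwo, IsDensityOperator ρ ∧
      IsDensityOperator σ ∧ IsBandLimited 0 ρ ∧ IsBandLimited 0 σ ∧
      ENNReal.ofReal (1 / 2 * (N : ℝ) ^ (-1 : ℝ)) ≤ hsNorm (σ - ρ) ∧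
      dataNorm (pinemT g σ - pinemT g ρ) ≤
        ((2 * ENNReal.ofReal Real.pi) ^ (1 / 2 : ℝ) * (2 * ‖2 * ‖g‖‖ₑ ^ 0)) *
          ENNReal.ofReal ((N : ℝ) ^ (-1 : ℝ)) := by
  have hN' : (0 : ℝ) < N := by exact_mod_cast hN
  rw [Real.rpow_neg_one]
  set δ : ℝ := (N : ℝ)⁻¹ with hδ
  have hδ0 : 0 < δ := by positivity
  have hδ1 : δ ≤ 1 := inv_le_one_of_one_le₀ (by exact_mod_cast hN)
  have hband : ∀ i, IsBandLimited 0 (matUnit i i) := fun i p q hpq => by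
    rw [matEntry_matUnit, if_neg]
    rintro ⟨hp, hq⟩
    simp [hp, hq] at hpq
  -- The halves compensate for the doubling of `symDiag` at `k = 0`.
  set a : ℤ → ℝ := fun j => if j = 0 then -(δ / 2) else if j = 1 then δ / 2 else 0 with ha
  have hs : ∀ j ∉ ({0, 1} : Finset ℤ), a j = 0 := by
    intro j hj
    simp only [Finset.mem_insert, Finset.mem_singleton, not_or] at hj
    simp [ha, hj.1, hj.2]
  have hsq : ∑ j ∈ ({0, 1} : Finset ℤ), a j ^ 2 = δ ^ 2 / 2 := by
    simp [ha]; ring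
  have hdiff : (((1 - δ : ℝ) : ℂ) • matUnit 0 0 + (δ : ℂ) • matUnit 1 1) - matUnit 0 0 =
      symDiag 0 {0, 1} a := by
    simp only [symDiag, ha, Finset.sum_pair (zero_ne_one (α := ℤ)), Nat.cast_zero, add_zero,
      if_true, one_ne_zero, if_false]
    push_cast
    module
  refine ⟨matUnit 0 0, ((1 - δ : ℝ) : ℂ) • matUnit 0 0 + (δ : ℂ) • matUnit 1 1,
    ⟨isPositive_matUnit_self 0, by simpa using hasSum_matEntry_matUnit 0 0⟩, ⟨?_, ?_⟩, hband 0,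
    fun p q hpq => ?_, ?_, ?_⟩
  · refine ((isPositive_matUnit_self 0).smul_of_nonneg ?_).add
      ((isPositive_matUnit_self 1).smul_of_nonneg ?_)
    · rw [Complex.zero_le_real]; linarith
    · rw [Complex.zero_le_real]; exact hδ0.le
  · simp_rw [matEntry_add, matEntry_smul]
    convert ((hasSum_matEntry_matUnit 0 0).mul_left ((1 - δ : ℝ) : ℂ)).add
      ((hasSum_matEntry_matUnit 1 1).mul_left (δ : ℂ)) using 1
    · rfl
    · simp
  · rw [matEntry_add, matEntry_smul, matEntry_smul, hband 0 p q hpq, hband 1 p q hpq]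
    simp
  · rw [hdiff]
    refine le_trans ?_ (seqNorm_le_hsNorm_symDiag 0 _ a hs)
    rw [← ENNReal.pow_le_pow_left_iff two_ne_zero, seqNorm_sq_of_support a _ hs, hsq,
      ← ENNReal.ofReal_pow (by positivity)]
    exact ENNReal.ofReal_le_ofReal (by nlinarith [sq_nonneg δ])
  · rw [← pinemT_sub, hdiff]
    refine (dataNorm_symDiag_le g 0 _ a hs).trans ?_
    gcongr
    rw [pow_zero, Module.End.one_apply, ← ENNReal.pow_le_pow_left_iff two_ne_zero,
      seqNorm_sq_of_support a _ hs, hsq, ← ENNReal.ofReal_pow (by positivity)]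
    exact ENNReal.ofReal_le_ofReal (by nlinarith [sq_nonneg δ])

theorem exists_density_const_mul_dataNorm_rpow_lt (g : ℂ) (k : ℕ) (μ : ℝ)
    (hμ : 1 / (1 + 2 * (k : ℝ)) < μ) (C : ℝ≥0) :
    ∃ ρ σ : EllTwo →L[ℂ] EllTwo, IsDensityOperator ρ ∧ IsDensityOperator σ ∧
      IsBandLimited k ρ ∧ IsBandLimited k σ ∧
      (C : ℝ≥0∞) * dataNorm (pinemT g σ - pinemT g ρ) ^ μ < hsNorm (σ - ρ) := by
  have hμ0 : 0 < μ := lt_trans (by positivity) hμ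
  have hpi : (2 * ENNReal.ofReal Real.pi) ^ (1 / 2 : ℝ) ≠ ⊤ :=
    ENNReal.rpow_ne_top_of_nonneg (by norm_num)
      (ENNReal.mul_ne_top ENNReal.ofNat_ne_top ENNReal.ofReal_ne_top)
  have hg : 2 * ‖2 * ‖g‖‖ₑ ^ k ≠ ⊤ :=
    ENNReal.mul_ne_top ENNReal.ofNat_ne_top (ENNReal.pow_ne_top enorm_ne_top)
  rcases eq_or_ne k 0 with rfl | hk
  · refine exists_density_of_scaling g 0 (by norm_num) (ENNReal.mul_ne_top hpi hg) hμ0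
      (p := 1) (q := 1) ?_ (exists_diagonal_density_pair g) C
    simpa using hμ
  · refine exists_density_of_scaling g k (by positivity) (ENNReal.mul_ne_top
      (ENNReal.mul_ne_top hpi hg) (ENNReal.pow_ne_top ENNReal.ofNat_ne_top)) hμ0
      (p := 1 / 2) (q := k + 1 / 2) ?_ (exists_density_pair_of_pos g hk) C
    rw [div_lt_iff₀ (by positivity)] at hμ
    linarith

theorem mainTheorem3 (g : ℂ) (k : ℕ) (μ : ℝ) (hμ : 1 / (1 + 2 * (k : ℝ)) < μ) :
    (∀ C : ℝ≥0, 0 < C → ∃ ρ σ : EllTwo →L[ℂ] EllTwo,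
      IsDensityOperator ρ ∧ IsDensityOperator σ ∧
      IsBandLimited k ρ ∧ IsBandLimited k σ ∧ ρ ≠ σ ∧
      (C : ℝ≥0∞) * dataNorm (pinemT g σ - pinemT g ρ) ^ μ ≤ hsNorm (σ - ρ)) ∧
    ¬ ∃ C : ℝ≥0, ∀ ρ σ : EllTwo →L[ℂ] EllTwo,
      IsDensityOperator ρ → IsDensityOperator σ →
      IsBandLimited k ρ → IsBandLimited k σ →
      hsNorm (σ - ρ) ≤ (C : ℝ≥0∞) * dataNorm (pinemT g σ - pinemT g ρ) ^ μ := by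
  refine ⟨fun C _ => ?_, fun ⟨C, hC⟩ => ?_⟩
  · obtain ⟨ρ, σ, h1, h2, h3, h4, h5⟩ := exists_density_const_mul_dataNorm_rpow_lt g k μ hμ C
    refine ⟨ρ, σ, h1, h2, h3, h4, ?_, h5.le⟩
    -- The strict inequality excludes equal states, whose difference has norm zero.
    rintro rfl
    simp [hsNorm, matEntry] at h5
  · obtain ⟨ρ, σ, h1, h2, h3, h4, h5⟩ := exists_density_const_mul_dataNorm_rpow_lt g k μ hμ C
    exact (hC ρ σ h1 h2 h3 h4).not_gt h5
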